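/- All rings are associative with unit, and ring homomorphisms and embeddings preserve the unit. A $*$-ring is a ring with an involution $r\mapsto r^*$; it is $*$-regular if for each $a$ there is $x$ with $axa=a$, and $rr^*=0$ only for $r=0$. An inner product space is a right vector space $V$ over a division $*$-ring $F$ with a sesquilinear form $\langle\cdot,\cdot\rangle$ such that $\langle v,v\rangle=0$ only for $v=0$, and $\langle v,w\rangle=0$ if and only if $\langle w,v\rangle=0$. A $*$-ring $R$ is representable if for some such $V$ there is an embedding $\iota$ of $R$ into the ring $\mathrm{End}^*(V_F)$ of those endomorphisms of $V_F$ that have an adjoint, such that $\iota(r^*)$ is the adjoint of $\iota(r)$ for each $r\in R$. A ring $S$ is subdirectly irreducible if it has a least non-zero two-sided ideal, which is then denoted by $M(S)$. A regular ring is semiartinian if each of its non-zero homomorphic images has non-zero socle, the socle being the sum of all minimal right ideals. Proposition. For every non-zero representable $*$-regular ring $R$ there is a subdirectly irreducible representable $*$-regular ring $\hat R$ such that $R$ embeds into $\hat R$ as a $*$-ring, $R\cong \hat R/M(\hat R)$ as $*$-rings (where $\hat R/M(\hat R)$ carries the involution $x+M(\hat R)\mapsto x^*+M(\hat R)$), and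 $\hat R$ is semiartinian if and only if $R$ is semiartinian. -/

import Mathlib

open MulOpposite

universe u

/-- A `*`-regular ring: a von Neumann regular ring with an involution such that `r r* = 0` only for
`r = 0`. -/
structure IsStarRegular (R : Type u) [Ring R] [StarRing R] : Prop where
  regular : ∀ a : R, ∃ x : R, a * x * a = a
  proper : ∀ r : R, r * star r = 0 → r = 0

/-- The structure of an inner product space on a right vector space `V` over a division `*`-ring
`F`: an anisotropic and orthosymmetric sesquilinear form. Right vector spaces over `F` are modules
over `Fᵐᵒᵖ`, with `v a = op a • v`. -/
structure InnerProductForm (F V : Type u) [DivisionRing F] [StarRing F] [AddCommGroup V]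
    [Module Fᵐᵒᵖ V] where
  form : V → V → F
  form_add_left : ∀ v v' w, form (v + v') w = form v w + form v' w
  form_add_right : ∀ v w w', form v (w + w') = form v w + form v w'
  form_smul_left : ∀ (a : F) (v w : V), form (op a • v) w = star a * form v w
  form_smul_right : ∀ (a : F) (v w : V), form v (op a • w) = form v w * a
  anisotropic : ∀ v, form v v = 0 → v = 0
  orthosymmetric : ∀ v w, form v w = 0 ↔ form w v = 0

namespace InnerProductForm

variable {F V : Type u} [DivisionRing F] [StarRing F] [AddCommGroup V] [Module Fᵐᵒᵖ V]

/-- `ψ` is the adjoint of `φ` (it is unique, the form being anisotropic). -/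
def IsAdjoint (B : InnerProductForm F V) (φ ψ : Module.End Fᵐᵒᵖ V) : Prop :=
  ∀ v w, B.form (φ v) w = B.form v (ψ w)

theorem form_zero_left (B : InnerProductForm F V) (w : V) : B.form 0 w = 0 := by
  simpa using B.form_smul_left 0 0 w

theorem form_zero_right (B : InnerProductForm F V) (v : V) : B.form v 0 = 0 := by
  simpa using B.form_smul_right 0 v 0

theorem form_neg_left (B : InnerProductForm F V) (v w : V) : B.form (-v) w = -B.form v w := by
  simpa using B.form_smul_left (-1) v w

theorem form_neg_right (B : InnerProductForm F V) (v w : V) : B.form v (-w) = -B.form v w := by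
  simpa using B.form_smul_right (-1) v w

/-- The ring `End*(V)` of those endomorphisms of the vector space `V` that have an adjoint. -/
def endStar (B : InnerProductForm F V) : Subring (Module.End Fᵐᵒᵖ V) where
  carrier := {φ | ∃ ψ, B.IsAdjoint φ ψ}
  zero_mem' := ⟨0, fun v w => by simp [form_zero_left, form_zero_right]⟩
  one_mem' := ⟨1, fun v w => rfl⟩
  add_mem' := by
    rintro φ φ' ⟨ψ, h⟩ ⟨ψ', h'⟩
    refine ⟨ψ + ψ', fun v w => ?_⟩
    rw [LinearMap.add_apply, LinearMap.add_apply, B.form_add_left, B.form_add_right, h, h']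
  mul_mem' := by
    rintro φ φ' ⟨ψ, h⟩ ⟨ψ', h'⟩
    exact ⟨ψ' * ψ, fun v w => (h (φ' v) w).trans (h' v (ψ w))⟩
  neg_mem' := by
    rintro φ ⟨ψ, h⟩
    refine ⟨-ψ, fun v w => ?_⟩
    rw [LinearMap.neg_apply, LinearMap.neg_apply, B.form_neg_left, B.form_neg_right, h]

end InnerProductForm

/-- A `*`-ring `R` is representable if it embeds, as a unital `*`-ring, into `End*(V)` for some
inner product space `V` over some division `*`-ring `F`; the involution of `End*(V)` is the
passage to the adjoint. -/
def IsRepresentable (R : Type u) [Ring R] [StarRing R] : Prop :=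
  ∃ (F V : Type u) (_ : DivisionRing F) (_ : StarRing F) (_ : AddCommGroup V)
    (_ : Module Fᵐᵒᵖ V) (B : InnerProductForm F V) (ι : R →+* B.endStar),
    Function.Injective ι ∧
      ∀ r : R, B.IsAdjoint (ι r : Module.End Fᵐᵒᵖ V) (ι (star r) : Module.End Fᵐᵒᵖ V)

/-- `M` is the unique minimal two-sided ideal of `R`, in the sense of subdirect irreducibility: it
is non-zero and contained in every non-zero two-sided ideal. -/
def IsMonolith {R : Type u} [Ring R] (M : TwoSidedIdeal R) : Prop :=
  IsLeast {J : TwoSidedIdeal R | J ≠ ⊥} M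

/-- The socle of a ring: the sum of all its minimal right ideals (right ideals of `S` are the
`Sᵐᵒᵖ`-submodules of `S`). -/
def rightSocle (S : Type u) [Ring S] : Submodule Sᵐᵒᵖ S :=
  sSup {N : Submodule Sᵐᵒᵖ S | IsAtom N}

/-- A (regular) ring is semiartinian if each of its non-zero homomorphic images has non-zero
socle. -/
def IsSemiartinian (R : Type u) [Ring R] : Prop :=
  ∀ I : TwoSidedIdeal R, I ≠ ⊤ → rightSocle I.ringCon.Quotient ≠ ⊥

/-! The operators of finite rank with an adjoint form an ideal `J` of `End*(V)` that lies in every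
non-zero ideal of any subring containing it. If `R` acts on `V` so that only `0` acts with finite
rank, then `R' = R + J` satisfies `R' / J ≅ R`, with `R` as a complement of its minimal ideal `J`.
Regularity lifts because both `J` and `R` are regular, and properness holds because the form is
anisotropic. Rank-one operators generate minimal right ideals, and a quotient of `R'` by a non-zero
ideal is a quotient of `R`; hence `R'` is semiartinian exactly when `R` is.

It remains to make every non-zero element act with infinite rank. A plain orthogonal sum of copies
of `V` may fail to be anisotropic. Instead, `V` is replaced by the Hahn series over `V` with
exponents in `Γ`, the free abelian group of countable rank ordered lexicographically. Scalars are
Hahn series over `F` acting through `t ↦ t²`; the form multiplies series, keeps the even exponents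
and halves them. The leading coefficient of `⟨v, v⟩` is the value of the old form at the leading
coefficient of `v`, so anisotropy survives. Since `Γ / 2Γ` is infinite, a vector `v` yields
infinitely many pairwise orthogonal copies `v t^γ`, and an operator with `φ v ≠ 0` acts with
infinite rank.

Passing to adjoints is an involution on `J` and on the Hahn extension once the form is hermitian up
to a scalar `c`. In dimension at least two this is automatic (`exists_isHermitianUpTo`); in
dimension one, `R` is a division ring and acts on itself. -/

namespace HahnSeries

/-! ### Inverses of Hahn series over a division ring -/

section Inverse

variable {Γ : Type*} [AddCommGroup Γ] [LinearOrder Γ] [IsOrderedAddMonoid Γ]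

/-- Well-founded induction on the exponent: a term of `x ^ (n + 1)` at `g` splits as `j + i` with `j
> 0` in the support of `x` and `i < g` in the support of `x ^ n`. There are only finitely many such
splittings, and each `i` occurs for finitely many `n`. -/
theorem finite_setOf_coeff_pow_ne_zero {A : Type*} [Ring A] {x : HahnSeries Γ A}
    (hx : 0 < x.orderTop) (g : Γ) : {n : ℕ | (x ^ n).coeff g ≠ 0}.Finite := by
  have hpwo : Set.IsPWO (⋃ n : ℕ, support (x ^ n)) :=
    SummableFamily.isPWO_iUnion_support_powers (zero_le_orderTop_iff.mp hx.le)
  by_cases h0 : x = 0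
  · exact h0 ▸ (Set.finite_singleton 0).subset (SummableFamily.co_support_zero g)
  by_cases hg : g ∈ ⋃ n : ℕ, {g | (x ^ n).coeff g ≠ 0}
  swap
  · exact Set.finite_empty.subset fun n hn => hg (Set.mem_iUnion.2 ⟨n, hn⟩)
  apply hpwo.isWF.induction hg
  intro y ys hy
  refine ((((Finset.antidiagonal x.isPWO_support hpwo y).finite_toSet.biUnion
    fun ij hij => hy ij.snd (Finset.mem_antidiagonal.1 (Finset.mem_coe.1 hij)).2.1 ?_).image
      Nat.succ).union (Set.finite_singleton 0)).subset ?_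
  · obtain ⟨hi, _, rfl⟩ := Finset.mem_antidiagonal.1 (Finset.mem_coe.1 hij)
    exact lt_add_of_pos_left ij.2 <| lt_of_lt_of_le ((zero_lt_orderTop_iff h0).mp hx) <|
      order_le_of_coeff_ne_zero <| Function.mem_support.mp hi
  · rintro (_ | n) hn
    · exact Set.mem_union_right _ (Set.mem_singleton 0)
    · obtain ⟨i, hi, j, hj, rfl⟩ := support_mul_subset hn
      refine Set.mem_union_left _ ⟨n, Set.mem_iUnion.2 ⟨⟨j, i⟩, Set.mem_iUnion.2 ⟨?_, hi⟩⟩, rfl⟩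
      simp only [Finset.mem_coe, Finset.mem_antidiagonal, mem_support, ne_eq, Set.mem_iUnion]
      exact ⟨hj, ⟨n, hi⟩, add_comm j i⟩

/-- The powers of a Hahn series of positive order, over a possibly noncommutative ring, as a
summable family. -/
noncomputable def powersFamily {A : Type*} [Ring A] (x : HahnSeries Γ A) (hx : 0 < x.orderTop) :
    SummableFamily Γ A ℕ where
  toFun n := x ^ n
  isPWO_iUnion_support' :=
    SummableFamily.isPWO_iUnion_support_powers (zero_le_orderTop_iff.mp hx.le)
  finite_co_support' g := finite_setOf_coeff_pow_ne_zero hx g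

theorem one_sub_mul_hsum_powersFamily {A : Type*} [Ring A] {x : HahnSeries Γ A}
    (hx : 0 < x.orderTop) : (1 - x) * (powersFamily x hx).hsum = 1 := by
  -- Telescoping: multiplication by `x`, shifted by one index, gives all the powers except the
  -- zeroth.
  have h : (x • powersFamily x hx).embDomain ⟨Nat.succ, Nat.succ_injective⟩ =
      powersFamily x hx - SummableFamily.ofFinsupp (Finsupp.single 0 1) := by
    apply SummableFamily.ext
    rintro (_ | n)
    · rw [SummableFamily.embDomain_of_notMem_range _ _ (by simp)]
      simp [powersFamily]
    · have := SummableFamily.embDomain_image (x • powersFamily x hx)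
        ⟨Nat.succ, Nat.succ_injective⟩ (a := n)
      rw [Function.Embedding.coeFn_mk, Nat.succ_eq_add_one] at this
      rw [this]
      simp [powersFamily, of_symm_smul_of_eq_mul, pow_succ', -smul_eq_mul]
  rw [sub_mul, one_mul, ← SummableFamily.hsum_smul,
    ← SummableFamily.hsum_embDomain (x • powersFamily x hx) ⟨Nat.succ, Nat.succ_injective⟩, h,
    SummableFamily.hsum_sub]
  simp

variable {F : Type*} [DivisionRing F]

/-- Dividing by the leading term makes the series start with `1`, so no exponent `≤ 0` survives in
the difference. -/
theorem orderTop_one_sub_single_mul_pos {x : HahnSeries Γ F} (hx : x ≠ 0) :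
    0 < (1 - single (-x.order) (x.leadingCoeff)⁻¹ * x).orderTop := by
  have hl : x.leadingCoeff ≠ 0 := leadingCoeff_ne_zero.mpr hx
  refine lt_of_not_ge fun h => ?_
  by_cases h1 : 1 - single (-x.order) (x.leadingCoeff)⁻¹ * x = 0
  · rw [h1, orderTop_zero] at h
    exact absurd h (by simp)
  have hc : (1 - single (-x.order) (x.leadingCoeff)⁻¹ * x).coeff
      (1 - single (-x.order) (x.leadingCoeff)⁻¹ * x).order ≠ 0 := by
    rwa [Ne, coeff_order_eq_zero]
  rw [← order_eq_orderTop_of_ne_zero h1, ← WithTop.coe_zero, WithTop.coe_le_coe] at h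
  generalize (1 - single (-x.order) (x.leadingCoeff)⁻¹ * x).order = g at h hc
  rw [coeff_sub, coeff_single_mul, sub_neg_eq_add, coeff_one] at hc
  rcases h.lt_or_eq with h | rfl
  · rw [if_neg h.ne, coeff_eq_zero_of_lt_order (by simpa using h)] at hc
    simp at hc
  · rw [if_pos rfl, zero_add, ← leadingCoeff_eq, inv_mul_cancel₀ hl] at hc
    simp at hc

theorem exists_mul_eq_one {x : HahnSeries Γ F} (hx : x ≠ 0) : ∃ y, x * y = 1 := by
  have hl : x.leadingCoeff ≠ 0 := leadingCoeff_ne_zero.mpr hx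
  have hs : single x.order x.leadingCoeff * single (-x.order) (x.leadingCoeff)⁻¹
      = (1 : HahnSeries Γ F) := by
    rw [single_mul_single, add_neg_cancel, mul_inv_cancel₀ hl, single_zero_one]
  have h := one_sub_mul_hsum_powersFamily (orderTop_one_sub_single_mul_pos hx)
  rw [sub_sub_cancel] at h
  generalize (powersFamily _ (orderTop_one_sub_single_mul_pos hx)).hsum = y at h
  refine ⟨y * single (-x.order) (x.leadingCoeff)⁻¹, ?_⟩
  have h2 : x * y = single x.order x.leadingCoeff := by
    calc x * y = single x.order x.leadingCoeff *
          (single (-x.order) (x.leadingCoeff)⁻¹ * x * y) := by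
            rw [← mul_assoc, ← mul_assoc, hs, one_mul]
      _ = _ := by rw [h, mul_one]
  rw [← mul_assoc, h2, hs]

/-- Hahn series over a division ring, with exponents in a linearly ordered abelian group, form a
division ring. -/
noncomputable abbrev divisionRing : DivisionRing (HahnSeries Γ F) :=
  DivisionRing.ofIsUnitOrEqZero fun x => by
    by_cases hx : x = 0
    · exact Or.inr hx
    · obtain ⟨y, hy⟩ := exists_mul_eq_one hx
      exact Or.inl ⟨⟨x, y, hy, by
        -- The right inverse `y` has itself a right inverse `z`, and then `x = x y z = z`.
        obtain ⟨z, hz⟩ := exists_mul_eq_one (right_ne_zero_of_mul_eq_one hy)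
        have : x = z := by rw [← mul_one x, ← hz, ← mul_assoc, hy, one_mul]
        rw [this, hz]⟩, rfl⟩

end Inverse

end HahnSeries

/-! ### Convolution along a biadditive map -/

namespace HahnSeries

section Convolution

open scoped Pointwise

variable {Γ : Type*} [AddCommGroup Γ] [LinearOrder Γ] [IsOrderedAddMonoid Γ]
variable {A B C D E G : Type*} [AddCommGroup A] [AddCommGroup B] [AddCommGroup C] [AddCommGroup D]
  [AddCommGroup E] [AddCommGroup G]

/-- The product of Hahn series with respect to a biadditive map of their coefficients. -/
noncomputable def conv (β : A →+ B →+ C) (x : HahnSeries Γ A) (y : HahnSeries Γ B) :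
    HahnSeries Γ C where
  coeff g := ∑ ij ∈ Finset.antidiagonal x.isPWO_support y.isPWO_support g,
    β (x.coeff ij.1) (y.coeff ij.2)
  isPWO_support' := by
    refine (Finset.isPWO_support_antidiagonal (hs := x.isPWO_support)
      (ht := y.isPWO_support)).mono fun g hg => ?_
    by_contra h
    exact hg ((congrArg (Finset.sum · _) (Finset.not_nonempty_iff_eq_empty.1 h)).trans
      Finset.sum_empty)

theorem coeff_conv_of_subset (β : A →+ B →+ C) {x : HahnSeries Γ A} {y : HahnSeries Γ B}
    {s t : Set Γ} (hs : s.IsPWO) (ht : t.IsPWO) (hxs : x.support ⊆ s) (hyt : y.support ⊆ t)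
    (g : Γ) :
    (conv β x y).coeff g = ∑ ij ∈ Finset.antidiagonal hs ht g, β (x.coeff ij.1) (y.coeff ij.2) := by
  refine Finset.sum_subset (fun ij hij => ?_) fun ij hij hn => ?_
  · rw [Finset.mem_antidiagonal] at hij ⊢
    exact ⟨hxs hij.1, hyt hij.2.1, hij.2.2⟩
  · rw [Finset.mem_antidiagonal] at hij hn
    by_cases hx : x.coeff ij.1 = 0
    · rw [hx, map_zero, AddMonoidHom.zero_apply]
    · by_cases hy : y.coeff ij.2 = 0
      · rw [hy, map_zero]
      · exact absurd ⟨hx, hy, hij.2.2⟩ hn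

theorem support_conv_subset (β : A →+ B →+ C) (x : HahnSeries Γ A) (y : HahnSeries Γ B) :
    (conv β x y).support ⊆ x.support + y.support := by
  intro g hg
  obtain ⟨ij, hij, -⟩ := Finset.exists_ne_zero_of_sum_ne_zero hg
  rw [Finset.mem_antidiagonal] at hij
  exact hij.2.2 ▸ Set.add_mem_add hij.1 hij.2.1

theorem hasFiniteSupport_conv (β : A →+ B →+ C) (x : HahnSeries Γ A) (y : HahnSeries Γ B) (g : Γ) :
    Function.HasFiniteSupport fun a => β (x.coeff a) (y.coeff (g - a)) := by
  refine ((Finset.antidiagonal x.isPWO_support y.isPWO_support g).image Prod.fst).finite_toSet.subset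
    fun a ha => ?_
  simp only [Finset.coe_image, Set.mem_image, Finset.mem_coe, Finset.mem_antidiagonal]
  refine ⟨(a, g - a), ⟨fun h => ha ?_, fun h => ha ?_, by simp⟩, rfl⟩
  · simp only [h, map_zero, AddMonoidHom.zero_apply]
  · simp only [h, map_zero]

/-- A form of the coefficient free of supports, so that identities can be checked termwise. -/
theorem coeff_conv (β : A →+ B →+ C) (x : HahnSeries Γ A) (y : HahnSeries Γ B) (g : Γ) :
    (conv β x y).coeff g = ∑ᶠ a, β (x.coeff a) (y.coeff (g - a)) := by
  symm
  rw [finsum_eq_sum_of_support_subset _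
    (s := (Finset.antidiagonal x.isPWO_support y.isPWO_support g).image Prod.fst)]
  · rw [Finset.sum_image]
    · refine Finset.sum_congr rfl fun ij hij => ?_
      rw [Finset.mem_antidiagonal] at hij
      rw [← hij.2.2, add_sub_cancel_left]
    · intro p hp q hq h
      rw [Finset.mem_coe, Finset.mem_antidiagonal] at hp hq
      refine Prod.ext h (add_left_cancel (a := p.1) ?_)
      rw [hp.2.2, h, hq.2.2]
  · intro a ha
    simp only [Finset.coe_image, Set.mem_image, Finset.mem_coe, Finset.mem_antidiagonal]
    refine ⟨(a, g - a), ⟨fun h => ha ?_, fun h => ha ?_, by simp⟩, rfl⟩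
    · simp only [h, map_zero, AddMonoidHom.zero_apply]
    · simp only [h, map_zero]

theorem conv_add (β : A →+ B →+ C) (x : HahnSeries Γ A) (y z : HahnSeries Γ B) :
    conv β x (y + z) = conv β x y + conv β x z := by
  ext g
  simp only [coeff_conv, coeff_add, map_add]
  exact finsum_add_distrib (hasFiniteSupport_conv β x y g) (hasFiniteSupport_conv β x z g)

theorem add_conv (β : A →+ B →+ C) (x y : HahnSeries Γ A) (z : HahnSeries Γ B) :
    conv β (x + y) z = conv β x z + conv β y z := by
  ext g
  simp only [coeff_conv, coeff_add, map_add, AddMonoidHom.add_apply]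
  exact finsum_add_distrib (hasFiniteSupport_conv β x z g) (hasFiniteSupport_conv β y z g)

theorem conv_flip (β : A →+ B →+ C) (x : HahnSeries Γ A) (y : HahnSeries Γ B) :
    conv β.flip y x = conv β x y := by
  ext g
  rw [coeff_conv, coeff_conv, ← finsum_comp_equiv (Equiv.subLeft g)]
  simp

theorem conv_map {A' B' C' : Type*} [AddCommGroup A'] [AddCommGroup B'] [AddCommGroup C']
    (β : A →+ B →+ C) (β' : A' →+ B' →+ C') (f : A →+ A') (f' : B →+ B') (h : C →+ C')
    (H : ∀ a b, β' (f a) (f' b) = h (β a b)) (x : HahnSeries Γ A) (y : HahnSeries Γ B) :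
    conv β' (x.map f) (y.map f') = (conv β x y).map h := by
  ext g
  rw [coeff_conv, map_coeff, coeff_conv, h.map_finsum (hasFiniteSupport_conv β x y g)]
  simp only [map_coeff, H]

theorem conv_mul {A : Type*} [Ring A] (x y : HahnSeries Γ A) :
    conv AddMonoidHom.mul x y = x * y := rfl

/-- Associativity with mixed types covers both the module law for scalars and the linearity of the
extended form. -/
theorem conv_assoc (β : A →+ B →+ D) (β' : D →+ C →+ E) (η : B →+ C →+ G) (η' : A →+ G →+ E)
    (H : ∀ a b c, β' (β a b) c = η' a (η b c))
    (x : HahnSeries Γ A) (y : HahnSeries Γ B) (z : HahnSeries Γ C) :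
    conv β' (conv β x y) z = conv η' x (conv η y z) := by
  ext g
  rw [coeff_conv_of_subset β' (x.isPWO_support.add y.isPWO_support) z.isPWO_support
      (support_conv_subset β x y) subset_rfl,
    coeff_conv_of_subset η' x.isPWO_support (y.isPWO_support.add z.isPWO_support)
      subset_rfl (support_conv_subset η y z)]
  simp only [conv, map_sum, AddMonoidHom.finsetSum_apply, Finset.sum_sigma']
  refine Finset.sum_nbij' (fun p => ⟨(p.2.1, p.2.2 + p.1.2), (p.2.2, p.1.2)⟩)
    (fun p => ⟨(p.1.1 + p.2.1, p.2.2), (p.1.1, p.2.1)⟩) ?_ ?_ ?_ ?_ ?_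
  · rintro ⟨⟨i, j⟩, ⟨k, l⟩⟩ h
    simp only [Finset.mem_sigma, Finset.mem_antidiagonal] at h ⊢
    obtain ⟨⟨-, hj, rfl⟩, hk, hl, rfl⟩ := h
    exact ⟨⟨hk, Set.add_mem_add hl hj, (add_assoc _ _ _).symm⟩, hl, hj, trivial⟩
  · rintro ⟨⟨i, j⟩, ⟨k, l⟩⟩ h
    simp only [Finset.mem_sigma, Finset.mem_antidiagonal] at h ⊢
    obtain ⟨⟨hi, -, rfl⟩, hk, hl, rfl⟩ := h
    exact ⟨⟨Set.add_mem_add hi hk, hl, add_assoc _ _ _⟩, hi, hk, trivial⟩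
  · rintro ⟨⟨i, j⟩, ⟨k, l⟩⟩ h
    simp only [Finset.mem_sigma, Finset.mem_antidiagonal] at h ⊢
    obtain ⟨⟨-, hj, rfl⟩, hk, hl, rfl⟩ := h
    rfl
  · rintro ⟨⟨i, j⟩, ⟨k, l⟩⟩ h
    simp only [Finset.mem_sigma, Finset.mem_antidiagonal] at h ⊢
    obtain ⟨⟨hi, -, rfl⟩, hk, hl, rfl⟩ := h
    rfl
  · rintro ⟨⟨i, j⟩, ⟨k, l⟩⟩ -
    exact H _ _ _

theorem coeff_conv_single_right (β : A →+ B →+ C) (x : HahnSeries Γ A) (k : Γ) (b : B) (g : Γ) :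
    (conv β x (single k b)).coeff g = β (x.coeff (g - k)) b := by
  rw [coeff_conv, finsum_eq_single _ (g - k)]
  · simp
  · intro a ha
    rw [coeff_single_of_ne fun h => ha (by rw [← h, sub_sub_cancel]), map_zero]

theorem coeff_conv_order_add_order (β : A →+ B →+ C) (x : HahnSeries Γ A) (y : HahnSeries Γ B) :
    (conv β x y).coeff (x.order + y.order) = β (x.coeff x.order) (y.coeff y.order) := by
  rw [coeff_conv, finsum_eq_single _ x.order]
  · simp
  · intro a ha
    rcases ha.lt_or_gt with h | h
    · rw [coeff_eq_zero_of_lt_order h, map_zero, AddMonoidHom.zero_apply]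
    · rw [coeff_eq_zero_of_lt_order (x := y), map_zero]
      rw [sub_lt_iff_lt_add, add_comm y.order]
      exact add_lt_add_left h _

end Convolution

/-! ### The coefficientwise involution -/

section Star

variable {Γ : Type*} [AddCommGroup Γ] [LinearOrder Γ] [IsOrderedAddMonoid Γ]

/-- The coefficientwise involution of Hahn series over a `*`-ring. -/
noncomputable instance instStarRing {F : Type*} [Ring F] [StarRing F] :
    StarRing (HahnSeries Γ F) where
  star x := x.map (starAddEquiv : F ≃+ F)
  star_involutive x := by ext; simp
  star_mul x y := by
    rw [← conv_mul, ← conv_mul, ← conv_flip]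
    refine (conv_map _ _ (starAddEquiv : F ≃+ F).toAddMonoidHom
      (starAddEquiv : F ≃+ F).toAddMonoidHom (starAddEquiv : F ≃+ F).toAddMonoidHom ?_ y x).symm
    intro a b
    simp
  star_add x y := by ext; simp

@[simp]
theorem coeff_star {F : Type*} [Ring F] [StarRing F] (x : HahnSeries Γ F) (g : Γ) :
    (star x).coeff g = star (x.coeff g) := rfl

end Star

/-! ### Doubling and halving of exponents -/

section Doubling

variable {Γ : Type*} [AddCommGroup Γ] [LinearOrder Γ] [IsOrderedAddMonoid Γ]

theorem strictMono_add_self : StrictMono fun g : Γ => g + g := fun _ _ h => add_lt_add h h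

/-- The endomorphism of the ring of Hahn series that doubles all exponents. -/
noncomputable def doubling {F : Type*} [Ring F] : HahnSeries Γ F →+* HahnSeries Γ F :=
  embDomainRingHom (AddMonoidHom.id Γ + AddMonoidHom.id Γ) strictMono_add_self.injective
    fun _ _ => strictMono_add_self.le_iff_le

@[simp]
theorem coeff_doubling_add_self {F : Type*} [Ring F] (x : HahnSeries Γ F) (g : Γ) :
    (doubling x).coeff (g + g) = x.coeff g :=
  embDomain_coeff (f := ⟨⟨fun g : Γ => g + g, strictMono_add_self.injective⟩,
    strictMono_add_self.le_iff_le⟩)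

theorem coeff_doubling_of_notMem {F : Type*} [Ring F] (x : HahnSeries Γ F) {g : Γ}
    (hg : g ∉ Set.range fun g : Γ => g + g) : (doubling x).coeff g = 0 :=
  embDomain_of_notMem_range (f := ⟨⟨fun g : Γ => g + g, strictMono_add_self.injective⟩,
    strictMono_add_self.le_iff_le⟩) hg

/-- The part of a Hahn series in the exponents divisible by two, with exponents halved. -/
def halving {A : Type*} [AddCommGroup A] (x : HahnSeries Γ A) : HahnSeries Γ A where
  coeff g := x.coeff (g + g)
  isPWO_support' := by
    rw [Set.isPWO_iff_isWF]
    have := x.isWF_support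
    rw [Set.isWF_iff_no_descending_seq] at this ⊢
    intro f hf hs
    exact this (fun n => f n + f n) (fun a b h => add_lt_add (hf h) (hf h)) fun n => hs n

@[simp]
theorem coeff_halving {A : Type*} [AddCommGroup A] (x : HahnSeries Γ A) (g : Γ) :
    (halving x).coeff g = x.coeff (g + g) := rfl

theorem finsum_eq_finsum_comp_of_injective {α β M : Type*} [AddCommMonoid M] {f : α → β}
    (hf : Function.Injective f) {φ : β → M} (hφ : ∀ b, b ∉ Set.range f → φ b = 0) :
    ∑ᶠ b, φ b = ∑ᶠ a, φ (f a) := by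
  rw [← finsum_mem_range hf, finsum_mem_def, Set.indicator_eq_self.2]
  exact fun b hb => by_contra fun h => hb (hφ b h)

/-- `doubling k` lives in even exponents, so an even exponent of the product only meets even
exponents of `x`. This makes the extended form linear over the doubled scalars. -/
theorem halving_mul_doubling {F : Type*} [Ring F] (x k : HahnSeries Γ F) :
    halving (x * doubling k) = halving x * k := by
  ext g
  rw [coeff_halving, ← conv_mul, ← conv_mul, ← conv_flip, coeff_conv, ← conv_flip, coeff_conv]
  have h : ∀ a, g + g - (a + a) = g - a + (g - a) := fun a => by abel
  rw [finsum_eq_finsum_comp_of_injective strictMono_add_self.injective]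
  · simp only [h, coeff_doubling_add_self, coeff_halving]
  · intro a ha
    rw [coeff_doubling_of_notMem k ha, map_zero, AddMonoidHom.zero_apply]

end Doubling

end HahnSeries

/-! ### Hahn series over a right module -/

namespace HahnSeries

section RightModule

variable {Γ : Type*} [AddCommGroup Γ] [LinearOrder Γ] [IsOrderedAddMonoid Γ]
variable {F V : Type*} [Ring F] [AddCommGroup V] [Module Fᵐᵒᵖ V]

/-- The right action of `F` on a right `F`-module, as a biadditive map. -/
def rightSMulHom (F V : Type*) [Ring F] [AddCommGroup V] [Module Fᵐᵒᵖ V] : V →+ F →+ V :=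
  AddMonoidHom.mk' (fun v => AddMonoidHom.mk' (fun a => op a • v) fun a b => by
    rw [op_add, add_smul]) fun v w => by ext a; exact smul_add _ _ _

@[simp]
theorem rightSMulHom_apply (v : V) (a : F) : rightSMulHom F V v a = op a • v := rfl

/-- Hahn series over a right `F`-module `V` form a right module over the Hahn series over `F`, where
the exponents of the scalars are doubled. -/
noncomputable abbrev doublingModule : Module (HahnSeries Γ F)ᵐᵒᵖ (HahnSeries Γ V) where
  smul k w := conv (rightSMulHom F V) w (doubling k.unop)
  one_smul w := by
    ext g
    change (conv (rightSMulHom F V) w (doubling 1)).coeff g = _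
    rw [map_one, ← single_zero_one, coeff_conv_single_right]
    simp
  mul_smul k l w := by
    change conv (rightSMulHom F V) w (doubling (l.unop * k.unop)) =
      conv (rightSMulHom F V) (conv (rightSMulHom F V) w (doubling l.unop)) (doubling k.unop)
    rw [map_mul, ← conv_mul]
    refine (conv_assoc _ _ _ _ (fun v a b => ?_) _ _ _).symm
    simp [mul_smul]
  smul_zero k := by
    ext g
    change (conv (rightSMulHom F V) 0 (doubling k.unop)).coeff g = _
    simp [coeff_conv]
  zero_smul w := by
    ext g
    change (conv (rightSMulHom F V) w (doubling 0)).coeff g = _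
    simp [coeff_conv]
  smul_add k v w := add_conv _ _ _ _
  add_smul k l w := by
    change conv (rightSMulHom F V) w (doubling (k.unop + l.unop)) = _
    rw [map_add, conv_add]
    rfl

attribute [local instance] doublingModule

theorem op_smul_eq_conv (k : HahnSeries Γ F) (w : HahnSeries Γ V) :
    op k • w = conv (rightSMulHom F V) w (doubling k) := rfl

/-- The coefficientwise action of an endomorphism on Hahn series. -/
noncomputable def mapEnd : Module.End Fᵐᵒᵖ V →+* Module.End (HahnSeries Γ F)ᵐᵒᵖ (HahnSeries Γ V) where
  toFun φ :=
    { toFun w := w.map φ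
      map_add' v w := by ext; simp
      map_smul' k w := by
        ext g
        change ((conv (rightSMulHom F V) w (doubling k.unop)).map φ).coeff g =
          (conv (rightSMulHom F V) (w.map φ) (doubling k.unop)).coeff g
        have h := conv_map (rightSMulHom F V) (rightSMulHom F V) φ.toAddMonoidHom
          (AddMonoidHom.id F) φ.toAddMonoidHom (fun v a => (φ.map_smul (op a) v).symm) w
          (doubling k.unop)
        exact (congrArg (fun z => coeff z g) h).symm }
  map_one' := by ext; rfl
  map_mul' φ ψ := by ext; rfl
  map_zero' := by ext; rfl
  map_add' φ ψ := by ext; rfl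

@[simp]
theorem coeff_mapEnd (φ : Module.End Fᵐᵒᵖ V) (w : HahnSeries Γ V) (g : Γ) :
    (mapEnd φ w).coeff g = φ (w.coeff g) := rfl

end RightModule

end HahnSeries

/-! ### The inner product space of Hahn series -/

namespace InnerProductForm

open HahnSeries

section HahnExtension

variable {Γ : Type} [AddCommGroup Γ] [LinearOrder Γ] [IsOrderedAddMonoid Γ]
variable {F V : Type u} [DivisionRing F] [StarRing F] [AddCommGroup V] [Module Fᵐᵒᵖ V]

/-- The form is hermitian up to the scalar `c`. -/
def IsHermitianUpTo (B : InnerProductForm F V) (c : F) : Prop :=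
  ∀ v w, star (B.form w v) = c * B.form v w

/-- The form, as a biadditive map. -/
def formHom (B : InnerProductForm F V) : V →+ V →+ F :=
  AddMonoidHom.mk' (fun v => AddMonoidHom.mk' (B.form v) (B.form_add_right v)) fun v v' => by
    ext w; exact B.form_add_left v v' w

@[simp]
theorem formHom_apply (B : InnerProductForm F V) (v w : V) : B.formHom v w = B.form v w := rfl

/-- The extension of the form to Hahn series. -/
noncomputable def hahnForm (B : InnerProductForm F V) (v w : HahnSeries Γ V) : HahnSeries Γ F :=
  halving (conv B.formHom v w)

theorem star_hahnForm (B : InnerProductForm F V) {c : F} (hc : B.IsHermitianUpTo c)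
    (v w : HahnSeries Γ V) : star (B.hahnForm w v) = single 0 c * B.hahnForm v w := by
  ext g
  rw [coeff_single_zero_mul, coeff_star]
  simp only [hahnForm, coeff_halving]
  rw [← conv_flip, coeff_conv, coeff_conv,
    ← starAddEquiv_apply, ← AddEquiv.coe_toAddMonoidHom,
    AddMonoidHom.map_finsum _ (hasFiniteSupport_conv _ _ _ _),
    ← AddMonoidHom.coe_mulLeft, AddMonoidHom.map_finsum _ (hasFiniteSupport_conv _ _ _ _)]
  refine finsum_congr fun a => ?_
  exact hc _ _

attribute [local instance] doublingModule HahnSeries.divisionRing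

theorem hahnForm_smul_right (B : InnerProductForm F V) (k : HahnSeries Γ F)
    (v w : HahnSeries Γ V) : B.hahnForm v (op k • w) = B.hahnForm v w * k := by
  rw [op_smul_eq_conv, hahnForm, hahnForm, ← halving_mul_doubling, ← conv_mul]
  congr 1
  refine (conv_assoc _ _ _ _ (fun v w a => ?_) _ _ _).symm
  simp [B.form_smul_right]

/-- The extension of an inner product space to Hahn series: scalars act with exponents doubled, and
the values of the form are restricted to the even exponents. -/
noncomputable def hahnExtension (B : InnerProductForm F V) {c : F} (hc : B.IsHermitianUpTo c)
    (hc0 : c ≠ 0) : InnerProductForm (HahnSeries Γ F) (HahnSeries Γ V) :=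
  have hstar : ∀ v w : HahnSeries Γ V,
      B.hahnForm v w = star (B.hahnForm w v) * star (single 0 c) := fun v w => by
    rw [← star_mul, ← B.star_hahnForm hc, star_star]
  { form := B.hahnForm
    form_add_left := fun v v' w => by
      ext g; simp [hahnForm, add_conv]
    form_add_right := fun v w w' => by
      ext g; simp [hahnForm, conv_add]
    -- Linearity on the right is carried to the left by the hermitian relation `hstar`.
    form_smul_left := fun a v w => by
      rw [hstar (op a • v) w, hahnForm_smul_right, star_mul, mul_assoc, ← hstar]
    form_smul_right := fun a v w => B.hahnForm_smul_right a v w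
    anisotropic := fun v hv => by
      -- Halving moves the lowest possible exponent `2 * v.order` to `v.order`; the coefficient
      -- there is the old form at the leading coefficient of `v`.
      have h := congrArg (fun x => coeff x v.order) hv
      simp only [hahnForm, coeff_halving, coeff_conv_order_add_order, coeff_zero] at h
      exact coeff_order_eq_zero.1 (B.anisotropic _ h)
    orthosymmetric := fun v w => by
      have hs : (single (0 : Γ) c) ≠ 0 := single_ne_zero hc0
      rw [← star_eq_zero, B.star_hahnForm hc, mul_eq_zero, or_iff_right hs] }

theorem hahnExtension_isHermitianUpTo (B : InnerProductForm F V) {c : F}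
    (hc : B.IsHermitianUpTo c) (hc0 : c ≠ 0) :
    (B.hahnExtension (Γ := Γ) hc hc0).IsHermitianUpTo (single 0 c) :=
  fun v w => B.star_hahnForm hc v w

theorem isAdjoint_mapEnd (B : InnerProductForm F V) {c : F} (hc : B.IsHermitianUpTo c)
    (hc0 : c ≠ 0) {φ ψ : Module.End Fᵐᵒᵖ V} (h : B.IsAdjoint φ ψ) :
    (B.hahnExtension (Γ := Γ) hc hc0).IsAdjoint (mapEnd φ) (mapEnd ψ) := by
  intro v w
  ext g
  change (conv B.formHom _ _).coeff (g + g) = (conv B.formHom _ _).coeff (g + g)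
  simp only [coeff_conv, coeff_mapEnd, formHom_apply, h _ _]

/-- The product sits in the single exponent `a + b`, which halving discards unless it is even. This
is the source of infinite orthogonal families. -/
theorem hahnExtension_form_single (B : InnerProductForm F V) {c : F} (hc : B.IsHermitianUpTo c)
    (hc0 : c ≠ 0) (a b : Γ) (hab : ∀ g, g + g ≠ a + b) (v w : V) :
    (B.hahnExtension (Γ := Γ) hc hc0).form (single a v) (single b w) = 0 := by
  ext g
  change (conv B.formHom _ _).coeff (g + g) = 0
  rw [coeff_conv_single_right, coeff_single_of_ne, map_zero, AddMonoidHom.zero_apply]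
  intro h
  exact hab g (by rw [← h, sub_add_cancel])

end HahnExtension

end InnerProductForm

/-! ### The socle and semiartinian rings -/

section Socle

/-- The condition on `s` says that `s S` is a minimal right ideal. -/
theorem rightSocle_ne_bot_iff {S : Type u} [Ring S] :
    rightSocle S ≠ ⊥ ↔ ∃ s : S, s ≠ 0 ∧ ∀ t, s * t ≠ 0 → ∃ t', s * t * t' = s := by
  rw [rightSocle, Ne, sSup_eq_bot]
  push Not
  constructor
  · rintro ⟨N, hN, hN0⟩
    obtain ⟨s, hs, hs0⟩ := N.ne_bot_iff.1 hN0
    refine ⟨s, hs0, fun t ht => ?_⟩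
    have hst : s * t ∈ N := N.smul_mem (op t) hs
    have hle : Submodule.span Sᵐᵒᵖ {s * t} ≤ N := by
      rwa [Submodule.span_singleton_le_iff_mem]
    have heq := (hN.le_iff.1 hle).resolve_left (by rwa [Submodule.span_singleton_eq_bot])
    rw [← heq, Submodule.mem_span_singleton] at hs
    obtain ⟨a, ha⟩ := hs
    exact ⟨a.unop, ha⟩
  · rintro ⟨s, hs0, hs⟩
    have h0 : Submodule.span Sᵐᵒᵖ {s} ≠ ⊥ := by rwa [Ne, Submodule.span_singleton_eq_bot]
    refine ⟨Submodule.span Sᵐᵒᵖ {s}, ⟨h0, fun N hN => ?_⟩, h0⟩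
    by_contra hN0
    obtain ⟨x, hx, hx0⟩ := N.ne_bot_iff.1 hN0
    obtain ⟨a, rfl⟩ := Submodule.mem_span_singleton.1 (hN.le hx)
    obtain ⟨t', ht'⟩ := hs a.unop hx0
    refine hN.not_ge ?_
    rw [Submodule.span_singleton_le_iff_mem, ← ht']
    exact N.smul_mem (op t') hx

theorem rightSocle_ne_bot_of_ringEquiv {S T : Type u} [Ring S] [Ring T] (e : S ≃+* T)
    (h : rightSocle S ≠ ⊥) : rightSocle T ≠ ⊥ := by
  rw [rightSocle_ne_bot_iff] at h ⊢
  obtain ⟨s, hs0, hs⟩ := h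
  refine ⟨e s, by simpa using hs0, fun t ht => ?_⟩
  obtain ⟨t, rfl⟩ := e.surjective t
  obtain ⟨t', ht'⟩ := hs t fun h => ht (by rw [← map_mul, h, map_zero])
  exact ⟨e t', by rw [← map_mul, ← map_mul, ht']⟩

theorem IsSemiartinian.rightSocle_ne_bot_of_surjective {A S : Type u} [Ring A] [Ring S]
    [Nontrivial S] (hA : IsSemiartinian A) (f : A →+* S) (hf : Function.Surjective f) :
    rightSocle S ≠ ⊥ := by
  refine rightSocle_ne_bot_of_ringEquiv (RingCon.quotientKerEquivOfSurjective f hf)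
    (hA (TwoSidedIdeal.ker f) fun h => ?_)
  have : (1 : A) ∈ TwoSidedIdeal.ker f := h ▸ TwoSidedIdeal.mem_top A
  rw [TwoSidedIdeal.mem_ker, map_one] at this
  exact one_ne_zero this

theorem TwoSidedIdeal.nontrivial_quotient {A : Type u} [Ring A] {I : TwoSidedIdeal A}
    (hI : I ≠ ⊤) : Nontrivial I.ringCon.Quotient := by
  refine ⟨⟨I.ringCon.mk' 1, 0, fun h => hI ?_⟩⟩
  have h1 : (1 : A) ∈ TwoSidedIdeal.ker I.ringCon.mk' := (TwoSidedIdeal.mem_ker _).2 h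
  rw [TwoSidedIdeal.ker_ringCon_mk'] at h1
  exact I.one_mem_iff.1 h1

theorem TwoSidedIdeal.surjective_mk' {A : Type u} [Ring A] (I : TwoSidedIdeal A) :
    Function.Surjective I.ringCon.mk' := Quotient.mk''_surjective

theorem IsSemiartinian.of_surjective {A S : Type u} [Ring A] [Ring S] (hA : IsSemiartinian A)
    (f : A →+* S) (hf : Function.Surjective f) : IsSemiartinian S := fun I hI =>
  have := TwoSidedIdeal.nontrivial_quotient hI
  hA.rightSocle_ne_bot_of_surjective (I.ringCon.mk'.comp f) (I.surjective_mk'.comp hf)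

/-- A non-zero ideal `I` contains `M`, so modulo `I` each `a` agrees with `f (p a)` and the quotient
is an image of `S`. For `I = ⊥` the quotient is `A` itself. -/
theorem isSemiartinian_of_isMonolith {A S : Type u} [Ring A] [Ring S] {M : TwoSidedIdeal A}
    (hM : IsMonolith M) (hsoc : rightSocle A ≠ ⊥) (p : A →+* S) (f : S →+* A)
    (hpf : ∀ a, a - f (p a) ∈ M) (hS : IsSemiartinian S) : IsSemiartinian A := by
  intro I hI
  by_cases h0 : I = ⊥
  · refine rightSocle_ne_bot_of_ringEquiv
      (RingEquiv.ofBijective I.ringCon.mk' ⟨?_, I.surjective_mk'⟩) hsoc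
    rw [← TwoSidedIdeal.ker_eq_bot, TwoSidedIdeal.ker_ringCon_mk', h0]
  · have := TwoSidedIdeal.nontrivial_quotient hI
    refine hS.rightSocle_ne_bot_of_surjective (I.ringCon.mk'.comp f) fun y => ?_
    obtain ⟨a, rfl⟩ := I.surjective_mk' y
    refine ⟨p a, ?_⟩
    have ha : a - f (p a) ∈ TwoSidedIdeal.ker I.ringCon.mk' := by
      rw [TwoSidedIdeal.ker_ringCon_mk']
      exact hM.2 h0 (hpf a)
    rw [TwoSidedIdeal.mem_ker, map_sub, sub_eq_zero] at ha
    exact ha.symm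

end Socle

/-! ### Operators of finite rank -/

namespace InnerProductForm

section FiniteRank

variable {F V : Type u} [DivisionRing F] [StarRing F] [AddCommGroup V] [Module Fᵐᵒᵖ V]

theorem form_sub_right (B : InnerProductForm F V) (v w w' : V) :
    B.form v (w - w') = B.form v w - B.form v w' := by
  rw [sub_eq_add_neg, B.form_add_right, B.form_neg_right, ← sub_eq_add_neg]

theorem form_self_ne_zero (B : InnerProductForm F V) {v : V} (hv : v ≠ 0) : B.form v v ≠ 0 :=
  fun h => hv (B.anisotropic v h)

theorem eq_of_isAdjoint (B : InnerProductForm F V) {φ ψ ψ' : Module.End Fᵐᵒᵖ V}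
    (h : B.IsAdjoint φ ψ) (h' : B.IsAdjoint φ ψ') : ψ = ψ' := by
  ext w
  rw [← sub_eq_zero]
  apply B.anisotropic
  rw [form_sub_right, ← h, ← h', sub_self]

theorem IsAdjoint.symm {B : InnerProductForm F V} {c : F} (hc : B.IsHermitianUpTo c)
    {φ ψ : Module.End Fᵐᵒᵖ V} (h : B.IsAdjoint φ ψ) : B.IsAdjoint ψ φ := fun v w => by
  rw [← star_inj, hc, ← h, hc]

theorem IsAdjoint.add {B : InnerProductForm F V} {φ ψ φ' ψ' : Module.End Fᵐᵒᵖ V}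
    (h : B.IsAdjoint φ ψ) (h' : B.IsAdjoint φ' ψ') : B.IsAdjoint (φ + φ') (ψ + ψ') := fun v w => by
  rw [LinearMap.add_apply, LinearMap.add_apply, B.form_add_left, B.form_add_right, h, h']

theorem IsAdjoint.neg {B : InnerProductForm F V} {φ ψ : Module.End Fᵐᵒᵖ V}
    (h : B.IsAdjoint φ ψ) : B.IsAdjoint (-φ) (-ψ) := fun v w => by
  rw [LinearMap.neg_apply, LinearMap.neg_apply, B.form_neg_left, B.form_neg_right, h]

theorem IsAdjoint.mul {B : InnerProductForm F V} {φ ψ φ' ψ' : Module.End Fᵐᵒᵖ V}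
    (h : B.IsAdjoint φ ψ) (h' : B.IsAdjoint φ' ψ') : B.IsAdjoint (φ * φ') (ψ' * ψ) := fun v w =>
  (h (φ' v) w).trans (h' v (ψ w))

/-- The operator `w ↦ x ⟨u, w⟩`. -/
def rankOne (B : InnerProductForm F V) (x u : V) : Module.End Fᵐᵒᵖ V where
  toFun w := op (B.form u w) • x
  map_add' w w' := by rw [B.form_add_right, op_add, add_smul]
  map_smul' a w := by
    rw [← op_unop a, B.form_smul_right, op_mul, mul_smul, RingHom.id_apply]

@[simp]
theorem rankOne_apply (B : InnerProductForm F V) (x u w : V) :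
    B.rankOne x u w = op (B.form u w) • x := rfl

theorem mul_rankOne (B : InnerProductForm F V) (φ : Module.End Fᵐᵒᵖ V) (x u : V) :
    φ * B.rankOne x u = B.rankOne (φ x) u := by
  ext w
  exact φ.map_smul _ _

theorem rankOne_mul (B : InnerProductForm F V) {φ ψ : Module.End Fᵐᵒᵖ V} (h : B.IsAdjoint ψ φ)
    (x u : V) : B.rankOne x u * φ = B.rankOne x (ψ u) := by
  ext w
  simp [h u w]

theorem rankOne_ne_zero (B : InnerProductForm F V) {x u : V} (hx : x ≠ 0) (hu : u ≠ 0) :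
    B.rankOne x u ≠ 0 := fun h => by
  have := LinearMap.congr_fun h u
  rw [rankOne_apply, LinearMap.zero_apply, smul_eq_zero, op_eq_zero_iff] at this
  exact this.elim (B.form_self_ne_zero hu) hx

theorem isAdjoint_rankOne (B : InnerProductForm F V) {c : F} (hc : B.IsHermitianUpTo c)
    (hc0 : c ≠ 0) (x u : V) :
    B.IsAdjoint (B.rankOne x u) (B.rankOne (op (star c)⁻¹ • u) x) := fun w z => by
  have h : B.form w u = star (B.form u w) * star c := by rw [← star_mul, ← hc, star_star]
  rw [rankOne_apply, rankOne_apply, B.form_smul_left, B.form_smul_right, B.form_smul_right, h,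
    mul_assoc (star _), mul_inv_cancel₀ (by simpa using hc0), mul_one]

/-- The operators of finite rank that have an adjoint. -/
def finiteRank (B : InnerProductForm F V) : AddSubgroup (Module.End Fᵐᵒᵖ V) :=
  AddSubgroup.closure {φ | ∃ x u, φ = B.rankOne x u}

theorem rankOne_mem_finiteRank (B : InnerProductForm F V) (x u : V) :
    B.rankOne x u ∈ B.finiteRank := AddSubgroup.subset_closure ⟨x, u, rfl⟩

@[elab_as_elim]
theorem finiteRank_induction (B : InnerProductForm F V) {p : Module.End Fᵐᵒᵖ V → Prop}
    (hone : ∀ x u, p (B.rankOne x u)) (hadd : ∀ φ ψ, p φ → p ψ → p (φ + ψ))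
    (hneg : ∀ φ, p φ → p (-φ)) (hzero : p 0) {φ : Module.End Fᵐᵒᵖ V} (hφ : φ ∈ B.finiteRank) :
    p φ :=
  AddSubgroup.closure_induction (p := fun φ _ => p φ) (by rintro _ ⟨x, u, rfl⟩; exact hone x u)
    hzero (fun φ ψ _ _ => hadd φ ψ) (fun φ _ => hneg φ) hφ

theorem mul_mem_finiteRank (B : InnerProductForm F V) (φ : Module.End Fᵐᵒᵖ V)
    {j : Module.End Fᵐᵒᵖ V} (hj : j ∈ B.finiteRank) : φ * j ∈ B.finiteRank := by
  refine B.finiteRank_induction (fun x u => ?_) (fun j j' h h' => ?_) (fun j h => ?_) ?_ hj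
  · rw [mul_rankOne]
    exact B.rankOne_mem_finiteRank _ _
  · rw [mul_add]
    exact add_mem h h'
  · rw [mul_neg]
    exact neg_mem h
  · rw [mul_zero]
    exact zero_mem _

theorem finiteRank_mul_mem (B : InnerProductForm F V) {φ ψ : Module.End Fᵐᵒᵖ V}
    (h : B.IsAdjoint ψ φ) {j : Module.End Fᵐᵒᵖ V} (hj : j ∈ B.finiteRank) :
    j * φ ∈ B.finiteRank := by
  refine B.finiteRank_induction (fun x u => ?_) (fun j j' h h' => ?_) (fun j h => ?_) ?_ hj
  · rw [rankOne_mul B h]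
    exact B.rankOne_mem_finiteRank _ _
  · rw [add_mul]
    exact add_mem h h'
  · rw [neg_mul]
    exact neg_mem h
  · rw [zero_mul]
    exact zero_mem _

theorem exists_isAdjoint_mem_finiteRank (B : InnerProductForm F V) {c : F}
    (hc : B.IsHermitianUpTo c) (hc0 : c ≠ 0) {j : Module.End Fᵐᵒᵖ V} (hj : j ∈ B.finiteRank) :
    ∃ k ∈ B.finiteRank, B.IsAdjoint j k := by
  refine B.finiteRank_induction (fun x u => ?_) ?_ ?_ ?_ hj
  · exact ⟨_, B.rankOne_mem_finiteRank _ _, B.isAdjoint_rankOne hc hc0 x u⟩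
  · rintro j j' ⟨k, hk, h⟩ ⟨k', hk', h'⟩
    exact ⟨k + k', add_mem hk hk', h.add h'⟩
  · rintro j ⟨k, hk, h⟩
    exact ⟨-k, neg_mem hk, h.neg⟩
  · exact ⟨0, zero_mem _, fun v w => by simp [form_zero_left, form_zero_right]⟩

theorem fg_range_of_mem_finiteRank (B : InnerProductForm F V) {j : Module.End Fᵐᵒᵖ V}
    (hj : j ∈ B.finiteRank) : (LinearMap.range j).FG := by
  have hle : ∀ {N N' : Submodule Fᵐᵒᵖ V}, N'.FG → N ≤ N' → N.FG := fun {N N'} hN' h => by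
    have : FiniteDimensional Fᵐᵒᵖ N' := Module.Finite.iff_fg.2 hN'
    exact Module.Finite.iff_fg.1 (Submodule.finiteDimensional_of_le h)
  refine B.finiteRank_induction (fun x u => ?_) (fun j j' h h' => ?_) (fun j h => ?_) ?_ hj
  · refine hle (Submodule.fg_span_singleton x) ?_
    rintro _ ⟨w, rfl⟩
    exact Submodule.smul_mem _ _ (Submodule.mem_span_singleton_self x)
  · exact hle (h.sup h') (LinearMap.range_add_le j j')
  · rwa [LinearMap.range_neg]
  · rw [LinearMap.range_zero]
    exact Submodule.fg_bot

/-- Finitely generated subspaces have orthogonal projections of finite rank. -/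
theorem exists_projection_mem_finiteRank (B : InnerProductForm F V) {U : Submodule Fᵐᵒᵖ V}
    (hU : U.FG) : ∃ P ∈ B.finiteRank, (∀ u ∈ U, P u = u) ∧ (∀ z, P z ∈ U) ∧
      ∀ u ∈ U, ∀ z, B.form u (z - P z) = 0 := by
  classical
  obtain ⟨s, rfl⟩ := hU
  induction s using Finset.induction_on with
  | empty =>
    refine ⟨0, zero_mem _, ?_, ?_, ?_⟩ <;> simp [form_zero_left]
  | insert x s _ ih =>
    obtain ⟨P, hP, hfix, hmem, hort⟩ := ih
    set U := Submodule.span Fᵐᵒᵖ (s : Set V)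
    set y := x - P x with hy
    have hyU : ∀ u ∈ U, B.form y u = 0 := fun u hu => (B.orthosymmetric _ _).1 (hort u hu x)
    have hUle : Submodule.span Fᵐᵒᵖ ((insert x s : Finset V) : Set V) =
        Submodule.span Fᵐᵒᵖ {x} ⊔ U := by
      rw [Finset.coe_insert, Submodule.span_insert]
    have hmemU : ∀ z, z ∈ Submodule.span Fᵐᵒᵖ {x} ⊔ U ↔ ∃ a : F, ∃ u ∈ U, op a • y + u = z := by
      intro z
      rw [Submodule.mem_sup]
      constructor
      · rintro ⟨v, hv, u, hu, rfl⟩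
        obtain ⟨a, rfl⟩ := Submodule.mem_span_singleton.1 hv
        refine ⟨a.unop, a • P x + u, add_mem (U.smul_mem _ (hmem x)) hu, ?_⟩
        rw [op_unop, hy, smul_sub]
        abel
      · rintro ⟨a, u, hu, rfl⟩
        refine ⟨op a • x, Submodule.smul_mem _ _ (Submodule.mem_span_singleton_self x),
          u - op a • P x, sub_mem hu (U.smul_mem _ (hmem x)), ?_⟩
        rw [hy, smul_sub]
        abel
    -- Gram–Schmidt: the projection onto the line of `y` is added to `P`. If `y = 0`, then `e = 0`
    -- and the added operator vanishes.
    set e := (B.form y y)⁻¹ with he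
    have hQ : ∀ z, (P + B.rankOne (op e • y) y) z = P z + op (e * B.form y z) • y := fun z => by
      rw [LinearMap.add_apply, rankOne_apply, smul_smul, ← op_mul]
    have hyy : op (e * B.form y y) • y = y := by
      by_cases h : y = 0
      · rw [h, smul_zero]
      · rw [he, inv_mul_cancel₀ (B.form_self_ne_zero h), op_one, one_smul]
    have hPy : P y = 0 := by rw [hy, map_sub, hfix _ (hmem x), sub_self]
    refine ⟨P + B.rankOne (op e • y) y, add_mem hP (B.rankOne_mem_finiteRank _ _), ?_, ?_, ?_⟩
    · intro z hz
      rw [hUle, hmemU] at hz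
      obtain ⟨a, u, hu, rfl⟩ := hz
      have h1 : (P + B.rankOne (op e • y) y) y = y := by rw [hQ, hPy, zero_add, hyy]
      have h2 : (P + B.rankOne (op e • y) y) u = u := by
        rw [hQ, hyU u hu, mul_zero, op_zero, zero_smul, add_zero, hfix u hu]
      rw [map_add, map_smul, h1, h2]
    · intro z
      rw [hUle, hmemU, hQ]
      exact ⟨_, _, hmem z, add_comm _ _⟩
    · intro w hw z
      rw [hUle, hmemU] at hw
      obtain ⟨a, u, hu, rfl⟩ := hw
      rw [B.form_add_left, B.form_smul_left, hQ, ← sub_sub, B.form_sub_right u, hort u hu,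
        B.form_smul_right, (B.orthosymmetric u y).2 (hyU u hu), zero_mul, sub_zero, add_zero,
        B.form_sub_right, B.form_sub_right, hyU _ (hmem z), sub_zero, B.form_smul_right,
        ← mul_assoc]
      by_cases h : y = 0
      · simp [h, form_zero_left]
      · rw [he, mul_inv_cancel₀ (B.form_self_ne_zero h), one_mul, sub_self, mul_zero]

/-- A linear section `g` of `j` need not have an adjoint, but `g * P` does for `P` the projection
onto the range of `j`: a left factor only moves the vector `x` of each `x ⟨u, ·⟩`. -/
theorem exists_mem_finiteRank_mul_mul_eq (B : InnerProductForm F V) {j : Module.End Fᵐᵒᵖ V}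
    (hj : j ∈ B.finiteRank) : ∃ k ∈ B.finiteRank, j * k * j = j := by
  obtain ⟨P, hP, hfix, -, -⟩ := B.exists_projection_mem_finiteRank (B.fg_range_of_mem_finiteRank hj)
  obtain ⟨s, hs⟩ := j.rangeRestrict.exists_rightInverse_of_surjective j.range_rangeRestrict
  obtain ⟨g, hg⟩ := LinearMap.exists_extend s
  refine ⟨g * P, B.mul_mem_finiteRank g hP, ?_⟩
  ext v
  have h1 : P (j v) = j v := hfix _ ⟨v, rfl⟩
  have h2 : g (j v) = s (j.rangeRestrict v) := LinearMap.congr_fun hg (j.rangeRestrict v)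
  have h3 := congrArg Subtype.val (LinearMap.congr_fun hs (j.rangeRestrict v))
  change j (g (P (j v))) = j v
  rw [h1, h2]
  exact h3

end FiniteRank

end InnerProductForm

/-! ### Extension of a represented ring by the operators of finite rank -/

namespace InnerProductForm

section FiniteRankExtension

variable {F V : Type u} [DivisionRing F] [StarRing F] [AddCommGroup V] [Module Fᵐᵒᵖ V]
variable {R : Type u} [Ring R] [StarRing R]

/-- The ring of those operators that differ by an operator of finite rank from an element of a
represented `*`-ring. -/
def finiteRankExtension (B : InnerProductForm F V) (D : R →+* Module.End Fᵐᵒᵖ V)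
    (hD : ∀ r, B.IsAdjoint (D r) (D (star r))) : Subring (Module.End Fᵐᵒᵖ V) where
  carrier := {φ | ∃ r, φ - D r ∈ B.finiteRank}
  zero_mem' := ⟨0, by rw [map_zero, sub_zero]; exact zero_mem _⟩
  one_mem' := ⟨1, by rw [map_one, sub_self]; exact zero_mem _⟩
  add_mem' := by
    rintro φ ψ ⟨r, hr⟩ ⟨s, hs⟩
    exact ⟨r + s, by rw [map_add, add_sub_add_comm]; exact add_mem hr hs⟩
  neg_mem' := by
    rintro φ ⟨r, hr⟩
    exact ⟨-r, by rw [map_neg, ← neg_sub']; exact neg_mem hr⟩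
  mul_mem' := by
    rintro φ ψ ⟨r, hr⟩ ⟨s, hs⟩
    refine ⟨r * s, ?_⟩
    have h : φ * ψ - D (r * s) = φ * (ψ - D s) + (φ - D r) * D s := by
      rw [map_mul, mul_sub, sub_mul]; abel
    have hs' : B.IsAdjoint (D (star s)) (D s) := by simpa using hD (star s)
    rw [h]
    exact add_mem (B.mul_mem_finiteRank φ hs) (B.finiteRank_mul_mem hs' hr)

variable (B : InnerProductForm F V) {c : F}
  (D : R →+* Module.End Fᵐᵒᵖ V) (hD : ∀ r, B.IsAdjoint (D r) (D (star r)))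

theorem finiteRank_le_finiteRankExtension {j : Module.End Fᵐᵒᵖ V} (hj : j ∈ B.finiteRank) :
    j ∈ B.finiteRankExtension D hD :=
  ⟨0, by rwa [map_zero, sub_zero]⟩

theorem exists_isAdjoint_finiteRankExtension {B : InnerProductForm F V} {c : F}
    (hc : B.IsHermitianUpTo c) (hc0 : c ≠ 0) {D : R →+* Module.End Fᵐᵒᵖ V}
    (hD : ∀ r, B.IsAdjoint (D r) (D (star r))) {φ : Module.End Fᵐᵒᵖ V} {r : R}
    (hr : φ - D r ∈ B.finiteRank) :
    ∃ ψ : Module.End Fᵐᵒᵖ V, ψ - D (star r) ∈ B.finiteRank ∧ B.IsAdjoint φ ψ := by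
  obtain ⟨k, hk, h⟩ := B.exists_isAdjoint_mem_finiteRank hc hc0 hr
  refine ⟨k + D (star r), by simpa using hk, ?_⟩
  simpa using h.add (hD r)

/-- The involution of the extension is the passage to the adjoint. -/
noncomputable abbrev finiteRankExtensionStarRing (hc : B.IsHermitianUpTo c) (hc0 : c ≠ 0) :
    StarRing (B.finiteRankExtension D hD) :=
  have hex : ∀ φ : B.finiteRankExtension D hD, ∃ ψ : B.finiteRankExtension D hD,
      B.IsAdjoint (φ : Module.End Fᵐᵒᵖ V) ψ := by
    rintro ⟨φ, r, hr⟩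
    obtain ⟨ψ, hψ, h⟩ := exists_isAdjoint_finiteRankExtension hc hc0 hD hr
    exact ⟨⟨ψ, star r, hψ⟩, h⟩
  have huniq : ∀ φ ψ : B.finiteRankExtension D hD, B.IsAdjoint (φ : Module.End Fᵐᵒᵖ V) ψ →
      (hex φ).choose = ψ := fun φ ψ h =>
    Subtype.ext (B.eq_of_isAdjoint (hex φ).choose_spec h)
  { star := fun φ => (hex φ).choose
    star_involutive := fun φ => huniq _ _ ((hex φ).choose_spec.symm hc)
    star_mul := fun φ ψ => huniq _ _ ((hex φ).choose_spec.mul (hex ψ).choose_spec)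
    star_add := fun φ ψ => huniq _ _ ((hex φ).choose_spec.add (hex ψ).choose_spec) }

theorem isAdjoint_star_finiteRankExtension (hc : B.IsHermitianUpTo c) (hc0 : c ≠ 0)
    (φ : B.finiteRankExtension D hD) :
    letI := B.finiteRankExtensionStarRing D hD hc hc0
    B.IsAdjoint (φ : Module.End Fᵐᵒᵖ V) (star φ : B.finiteRankExtension D hD) := by
  obtain ⟨φ, r, hr⟩ := φ
  have hex : ∃ ψ : B.finiteRankExtension D hD, B.IsAdjoint φ ψ := by
    obtain ⟨ψ, hψ, h⟩ := exists_isAdjoint_finiteRankExtension hc hc0 hD hr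
    exact ⟨⟨ψ, star r, hψ⟩, h⟩
  exact hex.choose_spec

theorem exists_mul_mul_eq_finiteRankExtension (hreg : ∀ a : R, ∃ x : R, a * x * a = a)
    (φ : B.finiteRankExtension D hD) : ∃ ψ, φ * ψ * φ = φ := by
  obtain ⟨φ, r, hr⟩ := φ
  obtain ⟨x, hx⟩ := hreg r
  have hs' : ∀ s, B.IsAdjoint (D (star s)) (D s) := fun s => by simpa using hD (star s)
  have hmem : ∀ s, D s ∈ B.finiteRankExtension D hD := fun s =>
    ⟨s, by rw [sub_self]; exact zero_mem _⟩
  -- Modulo finite rank `φ` is `D r`, and `x` is a quasi-inverse of `r`.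
  have ha : φ - φ * D x * φ ∈ B.finiteRank := by
    have h : φ - φ * D x * φ =
        (φ - D r) - φ * D x * (φ - D r) - (φ - D r) * D (x * r) := by
      have h1 : D r * D x * D r = D r := by rw [← map_mul, ← map_mul, hx]
      have h2 : (φ - D r) * D (x * r) = φ * D x * D r - D r := by
        rw [map_mul, sub_mul, ← mul_assoc, ← mul_assoc, h1]
      rw [h2, mul_sub]; abel
    rw [h]
    exact sub_mem (sub_mem hr (B.mul_mem_finiteRank _ hr)) (B.finiteRank_mul_mem (hs' _) hr)
  obtain ⟨k, hk, hkk⟩ := B.exists_mem_finiteRank_mul_mul_eq ha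
  let φ' : B.finiteRankExtension D hD := ⟨φ, r, hr⟩
  let x' : B.finiteRankExtension D hD := ⟨D x, hmem x⟩
  let k' : B.finiteRankExtension D hD := ⟨k, B.finiteRank_le_finiteRankExtension D hD hk⟩
  have hk' : (φ' - φ' * x' * φ') * k' * (φ' - φ' * x' * φ') = φ' - φ' * x' * φ' := Subtype.ext hkk
  -- If `a - a x a` has quasi-inverse `k`, then `(1 - x a) k (1 - a x) + x` is one of `a`.
  refine ⟨(1 - x' * φ') * k' * (1 - φ' * x') + x', ?_⟩
  change φ' * ((1 - x' * φ') * k' * (1 - φ' * x') + x') * φ' = φ'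
  calc φ' * ((1 - x' * φ') * k' * (1 - φ' * x') + x') * φ'
      = (φ' - φ' * x' * φ') * k' * (φ' - φ' * x' * φ') + φ' * x' * φ' := by noncomm_ring
    _ = φ' := by rw [hk', sub_add_cancel]

theorem isStarRegular_finiteRankExtension (hc : B.IsHermitianUpTo c) (hc0 : c ≠ 0)
    (hreg : ∀ a : R, ∃ x : R, a * x * a = a) :
    letI := B.finiteRankExtensionStarRing D hD hc hc0
    IsStarRegular (B.finiteRankExtension D hD) := by
  let _ := B.finiteRankExtensionStarRing D hD hc hc0
  refine ⟨B.exists_mul_mul_eq_finiteRankExtension D hD hreg, fun φ hφ => ?_⟩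
  have hadj := B.isAdjoint_star_finiteRankExtension D hD hc hc0 φ
  have h0 : star φ = 0 := by
    -- Here `⟨φ* v, φ* v⟩ = ⟨v, φ φ* v⟩ = 0`, so anisotropy gives `φ* v = 0`.
    refine Subtype.ext (LinearMap.ext fun v => B.anisotropic _ ?_)
    have := (hadj.symm hc) v ((star φ : B.finiteRankExtension D hD).1 v)
    rw [this]
    have h1 : (φ.1 * (star φ : B.finiteRankExtension D hD).1) v = 0 := by
      rw [← Subring.coe_mul, hφ]; rfl
    change B.form v ((φ.1 * (star φ : B.finiteRankExtension D hD).1) v) = 0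
    rw [h1, form_zero_right]
  rw [← star_star φ, h0, star_zero]

theorem isRepresentable_finiteRankExtension (hc : B.IsHermitianUpTo c) (hc0 : c ≠ 0) :
    letI := B.finiteRankExtensionStarRing D hD hc hc0
    IsRepresentable (B.finiteRankExtension D hD) := by
  let _ := B.finiteRankExtensionStarRing D hD hc hc0
  have hle : B.finiteRankExtension D hD ≤ B.endStar := fun φ hφ =>
    ⟨_, B.isAdjoint_star_finiteRankExtension D hD hc hc0 ⟨φ, hφ⟩⟩
  exact ⟨F, V, _, _, _, _, B, Subring.inclusion hle, Subring.inclusion_injective hle,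
    B.isAdjoint_star_finiteRankExtension D hD hc hc0⟩

variable {D}

/-- The projection of the extension onto the represented ring. -/
noncomputable def extensionProj (hinf : ∀ r, D r ∈ B.finiteRank → r = 0) :
    B.finiteRankExtension D hD →+* R :=
  have huniq : ∀ (φ : B.finiteRankExtension D hD) (r : R),
      (φ : Module.End Fᵐᵒᵖ V) - D r ∈ B.finiteRank → φ.2.choose = r := fun φ r h => by
    rw [← sub_eq_zero]
    apply hinf
    rw [map_sub]
    simpa using sub_mem h φ.2.choose_spec
  { toFun := fun φ => φ.2.choose
    map_one' := huniq _ _ (by rw [map_one]; simp)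
    map_zero' := huniq _ _ (by rw [map_zero]; simp)
    map_add' := fun φ ψ => huniq _ _ (by
      rw [map_add, Subring.coe_add, add_sub_add_comm]
      exact add_mem φ.2.choose_spec ψ.2.choose_spec)
    map_mul' := fun φ ψ => huniq _ _ (by
      have hs : B.IsAdjoint (D (star ψ.2.choose)) (D ψ.2.choose) := by
        simpa using hD (star ψ.2.choose)
      have h : (φ * ψ : B.finiteRankExtension D hD).1 - D (φ.2.choose * ψ.2.choose) =
          φ.1 * (ψ.1 - D ψ.2.choose) + (φ.1 - D φ.2.choose) * D ψ.2.choose := by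
        rw [map_mul, mul_sub, sub_mul, Subring.coe_mul]; abel
      rw [h]
      exact add_mem (B.mul_mem_finiteRank _ ψ.2.choose_spec)
        (B.finiteRank_mul_mem hs φ.2.choose_spec)) }

theorem sub_extensionProj_mem (hinf : ∀ r, D r ∈ B.finiteRank → r = 0)
    (φ : B.finiteRankExtension D hD) :
    (φ : Module.End Fᵐᵒᵖ V) - D (B.extensionProj hD hinf φ) ∈ B.finiteRank :=
  φ.2.choose_spec

theorem extensionProj_eq_iff (hinf : ∀ r, D r ∈ B.finiteRank → r = 0)
    (φ : B.finiteRankExtension D hD) (r : R) :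
    B.extensionProj hD hinf φ = r ↔ (φ : Module.End Fᵐᵒᵖ V) - D r ∈ B.finiteRank := by
  refine ⟨fun h => h ▸ B.sub_extensionProj_mem hD hinf φ, fun h => ?_⟩
  rw [← sub_eq_zero]
  apply hinf
  rw [map_sub]
  simpa using sub_mem h (B.sub_extensionProj_mem hD hinf φ)

theorem mem_ker_extensionProj (hinf : ∀ r, D r ∈ B.finiteRank → r = 0)
    (φ : B.finiteRankExtension D hD) :
    φ ∈ TwoSidedIdeal.ker (B.extensionProj hD hinf) ↔
      (φ : Module.End Fᵐᵒᵖ V) ∈ B.finiteRank := by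
  rw [TwoSidedIdeal.mem_ker, extensionProj_eq_iff, map_zero, sub_zero]

theorem extensionProj_star (hc : B.IsHermitianUpTo c) (hc0 : c ≠ 0)
    (hinf : ∀ r, D r ∈ B.finiteRank → r = 0) (φ : B.finiteRankExtension D hD) :
    letI := B.finiteRankExtensionStarRing D hD hc hc0
    B.extensionProj hD hinf (star φ) = star (B.extensionProj hD hinf φ) := by
  let _ := B.finiteRankExtensionStarRing D hD hc hc0
  rw [extensionProj_eq_iff]
  obtain ⟨ψ, hψ, h⟩ :=
    exists_isAdjoint_finiteRankExtension hc hc0 hD (B.sub_extensionProj_mem hD hinf φ)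
  rwa [B.eq_of_isAdjoint (B.isAdjoint_star_finiteRankExtension D hD hc hc0 φ) h]

theorem isMonolith_ker_extensionProj [Nontrivial V] (hinf : ∀ r, D r ∈ B.finiteRank → r = 0) :
    IsMonolith (TwoSidedIdeal.ker (B.extensionProj hD hinf)) := by
  have hmem : ∀ {j}, j ∈ B.finiteRank → j ∈ B.finiteRankExtension D hD :=
    B.finiteRank_le_finiteRankExtension D hD
  have hone := B.rankOne_mem_finiteRank
  constructor
  · intro h
    obtain ⟨x, hx⟩ := exists_ne (0 : V)
    have h1 : (⟨B.rankOne x x, hmem (hone x x)⟩ : B.finiteRankExtension D hD) ∈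
        TwoSidedIdeal.ker (B.extensionProj hD hinf) :=
      (B.mem_ker_extensionProj hD hinf _).2 (hone x x)
    rw [h, TwoSidedIdeal.mem_bot] at h1
    exact B.rankOne_ne_zero hx hx (congrArg Subtype.val h1)
  · intro I hI φ hφ
    have hφ' := (B.mem_ker_extensionProj hD hinf φ).1 hφ
    obtain ⟨ψ, hψ, hψ0⟩ : ∃ ψ ∈ I, ψ ≠ 0 := by
      by_contra! h
      exact hI (eq_bot_iff.2 fun ψ hψ => (TwoSidedIdeal.mem_bot _).2 (h ψ hψ))
    obtain ⟨w, hw⟩ : ∃ w, ψ.1 w ≠ 0 := by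
      by_contra! h
      exact hψ0 (Subtype.ext (LinearMap.ext h))
    -- With `b = ⟨ψ w, ψ w⟩`, the operator `x ⟨u, ·⟩` is the product of `x b⁻¹ ⟨ψ w, ·⟩`, `ψ` and `w
    -- ⟨u, ·⟩`.
    have hrank : ∀ x u, (⟨B.rankOne x u, hmem (hone x u)⟩ : B.finiteRankExtension D hD) ∈ I := by
      intro x u
      have hb := B.form_self_ne_zero hw
      set b := B.form (ψ.1 w) (ψ.1 w)
      have h1 := I.mul_mem_right _ (⟨B.rankOne w u, hmem (hone w u)⟩ : B.finiteRankExtension D hD)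
        (I.mul_mem_left (⟨B.rankOne (op b⁻¹ • x) (ψ.1 w), hmem (hone _ _)⟩ :
          B.finiteRankExtension D hD) ψ hψ)
      convert h1 using 1
      apply Subtype.ext
      rw [Subring.coe_mul, Subring.coe_mul, mul_rankOne]
      refine congrArg (B.rankOne · u) ?_
      change x = op b • op b⁻¹ • x
      rw [smul_smul, ← op_mul, inv_mul_cancel₀ hb, op_one, one_smul]
    have hall : ∃ h : φ.1 ∈ B.finiteRankExtension D hD,
        (⟨φ.1, h⟩ : B.finiteRankExtension D hD) ∈ I := by
      refine B.finiteRank_induction (fun x u => ⟨_, hrank x u⟩) ?_ ?_ ?_ hφ'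
      · rintro j j' ⟨h, hj⟩ ⟨h', hj'⟩
        exact ⟨add_mem h h', I.add_mem hj hj'⟩
      · rintro j ⟨h, hj⟩
        exact ⟨neg_mem h, I.neg_mem hj⟩
      · exact ⟨zero_mem _, I.zero_mem⟩
    exact hall.2

/-- For `s = x ⟨x, ·⟩` and `s t ≠ 0`, some `y` has `a = ⟨x, t y⟩ ≠ 0`, and `y a⁻¹ ⟨x, ·⟩` brings `s
t` back to `s`. -/
theorem rightSocle_finiteRankExtension_ne_bot [Nontrivial V] :
    rightSocle (B.finiteRankExtension D hD) ≠ ⊥ := by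
  rw [rightSocle_ne_bot_iff]
  have hmem : ∀ x u, B.rankOne x u ∈ B.finiteRankExtension D hD := fun x u =>
    B.finiteRank_le_finiteRankExtension D hD (B.rankOne_mem_finiteRank x u)
  obtain ⟨x, hx⟩ := exists_ne (0 : V)
  refine ⟨⟨B.rankOne x x, hmem x x⟩, fun h => B.rankOne_ne_zero hx hx (congrArg Subtype.val h),
    fun t ht => ?_⟩
  obtain ⟨y, hy⟩ : ∃ y, B.form x (t.1 y) ≠ 0 := by
    by_contra! h
    refine ht (Subtype.ext (LinearMap.ext fun y => ?_))
    change op (B.form x (t.1 y)) • x = 0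
    rw [h, op_zero, zero_smul]
  refine ⟨⟨B.rankOne (op (B.form x (t.1 y))⁻¹ • y) x, hmem _ _⟩, Subtype.ext ?_⟩
  rw [Subring.coe_mul, Subring.coe_mul, mul_rankOne]
  congr 1
  rw [map_smul]
  change op (B.form x (t.1 y))⁻¹ • op (B.form x (t.1 y)) • x = x
  rw [smul_smul, ← op_mul, mul_inv_cancel₀ hy, op_one, one_smul]

/-- The main construction, for a representation without non-zero operators of finite rank. -/
theorem exists_subdirectly_irreducible_extension [Nontrivial V]
    (hD : ∀ r, B.IsAdjoint (D r) (D (star r))) (hc : B.IsHermitianUpTo c)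
    (hc0 : c ≠ 0) (hreg : IsStarRegular R) (hinf : ∀ r, D r ∈ B.finiteRank → r = 0) :
    ∃ (R' : Type u) (_ : Ring R') (_ : StarRing R') (M : TwoSidedIdeal R'),
      IsStarRegular R' ∧ IsRepresentable R' ∧ IsMonolith M ∧
      (∃ f : R →+* R', Function.Injective f ∧ ∀ r, f (star r) = star (f r)) ∧
      (∃ e : M.ringCon.Quotient ≃+* R,
        ∀ x : R', e (M.ringCon.mk' (star x)) = star (e (M.ringCon.mk' x))) ∧
      (IsSemiartinian R' ↔ IsSemiartinian R) := by
  let _ := B.finiteRankExtensionStarRing D hD hc hc0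
  have hDmem : ∀ r, D r ∈ B.finiteRankExtension D hD := fun r =>
    ⟨r, by rw [sub_self]; exact zero_mem _⟩
  let f : R →+* B.finiteRankExtension D hD := D.codRestrict _ hDmem
  let p := B.extensionProj hD hinf
  have hpf : ∀ r, p (f r) = r := fun r =>
    (B.extensionProj_eq_iff hD hinf _ _).2 (by
      change D r - D r ∈ _
      rw [sub_self]
      exact zero_mem _)
  have hp : Function.Surjective p := fun r => ⟨f r, hpf r⟩
  have hM := B.isMonolith_ker_extensionProj hD hinf
  refine ⟨B.finiteRankExtension D hD, inferInstance, inferInstance, TwoSidedIdeal.ker p,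
    B.isStarRegular_finiteRankExtension D hD hc hc0 hreg.regular,
    B.isRepresentable_finiteRankExtension D hD hc hc0, hM,
    ⟨f, Function.LeftInverse.injective hpf, fun r => Subtype.ext ?_⟩,
    ⟨RingCon.quotientKerEquivOfSurjective p hp, fun φ => ?_⟩,
    fun h => h.of_surjective p hp,
    isSemiartinian_of_isMonolith hM (B.rightSocle_finiteRankExtension_ne_bot hD) p f fun φ => ?_⟩
  · exact B.eq_of_isAdjoint (hD r) (B.isAdjoint_star_finiteRankExtension D hD hc hc0 (f r))
  · exact B.extensionProj_star hD hc hc0 hinf φ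
  · rw [TwoSidedIdeal.mem_ker, map_sub, hpf, sub_self]

end FiniteRankExtension

end InnerProductForm

/-! ### A criterion for infinite rank -/

namespace InnerProductForm

section InfiniteRank

variable {F V : Type u} [DivisionRing F] [StarRing F] [AddCommGroup V] [Module Fᵐᵒᵖ V]

theorem linearIndependent_of_orthogonal (B : InnerProductForm F V) {α : Type*} {w : α → V}
    (h0 : ∀ i, w i ≠ 0) (hort : ∀ i j, i ≠ j → B.form (w i) (w j) = 0) :
    LinearIndependent Fᵐᵒᵖ w := by
  rw [linearIndependent_iff']
  intro s g hg i hi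
  have h := congrArg (B.formHom (w i)) hg
  rw [map_sum, map_zero, Finset.sum_eq_single_of_mem i hi] at h
  · rw [formHom_apply, ← op_unop (g i), B.form_smul_right, mul_eq_zero] at h
    exact (unop_eq_zero_iff _).1 (h.resolve_left (B.form_self_ne_zero (h0 i)))
  · intro j _ hj
    rw [formHom_apply, ← op_unop (g j), B.form_smul_right, hort i j hj.symm, zero_mul]

theorem notMem_finiteRank_of_orthogonal (B : InnerProductForm F V) {φ : Module.End Fᵐᵒᵖ V}
    {v : ℕ → V} (h0 : ∀ i, φ (v i) ≠ 0)
    (hort : ∀ i j, i ≠ j → B.form (φ (v i)) (φ (v j)) = 0) : φ ∉ B.finiteRank := by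
  intro hφ
  have hli := B.linearIndependent_of_orthogonal h0 hort
  have : FiniteDimensional Fᵐᵒᵖ (LinearMap.range φ) :=
    Module.Finite.iff_fg.2 (B.fg_range_of_mem_finiteRank hφ)
  have hli' : LinearIndependent Fᵐᵒᵖ fun i => φ.rangeRestrict (v i) :=
    LinearIndependent.of_comp (LinearMap.range φ).subtype hli
  exact Infinite.not_finite (α := ℕ) hli'.finite_of_isNoetherian

end InfiniteRank

/-! ### Orthosymmetric forms are hermitian up to a scalar -/

section Hermitian

variable {F V : Type u} [DivisionRing F] [StarRing F] [AddCommGroup V] [Module Fᵐᵒᵖ V]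

/-- Removing from `w` its component along `v` leaves a vector orthogonal to `v` on both sides, so
only the multiple of `v` matters. The scalar may still depend on `v`. -/
theorem star_form_eq (B : InnerProductForm F V) {v : V} (hv : v ≠ 0) (w : V) :
    star (B.form w v) = star (B.form v v) * (B.form v v)⁻¹ * B.form v w := by
  have hvv := B.form_self_ne_zero hv
  set a := (B.form v v)⁻¹ * B.form v w with ha
  have h1 : B.form v (w - op a • v) = 0 := by
    rw [B.form_sub_right, B.form_smul_right, ha, ← mul_assoc, mul_inv_cancel₀ hvv, one_mul, sub_self]
  have h2 : B.form w v = star a * B.form v v := by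
    have := (B.orthosymmetric _ _).1 h1
    rwa [sub_eq_add_neg, B.form_add_left, B.form_neg_left, B.form_smul_left, ← sub_eq_add_neg,
      sub_eq_zero] at this
  rw [h2, star_mul, star_star, ha, mul_assoc]

theorem exists_form_eq_zero_form_ne_zero (B : InnerProductForm F V) {v u : V} (hv : v ≠ 0)
    (hu : u ∉ Submodule.span Fᵐᵒᵖ {v}) : ∃ w, B.form v w = 0 ∧ B.form u w ≠ 0 := by
  have hvv := B.form_self_ne_zero hv
  set a := (B.form v v)⁻¹ * B.form v u with ha
  have h1 : B.form v (u - op a • v) = 0 := by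
    rw [B.form_sub_right, B.form_smul_right, ha, ← mul_assoc, mul_inv_cancel₀ hvv, one_mul, sub_self]
  refine ⟨u - op a • v, h1, fun h2 => hu ?_⟩
  have h3 : u - op a • v = 0 := by
    apply B.anisotropic
    rw [B.form_sub_right, B.form_smul_right, (B.orthosymmetric _ _).1 h1, zero_mul, sub_zero,
      B.orthosymmetric, h2]
  rw [sub_eq_zero.1 h3]
  exact Submodule.smul_mem _ _ (Submodule.mem_span_singleton_self v)

theorem form_scalar_eq (B : InnerProductForm F V) {v u : V} (hv : v ≠ 0)
    (hu : u ∉ Submodule.span Fᵐᵒᵖ {v}) :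
    star (B.form v v) * (B.form v v)⁻¹ = star (B.form u u) * (B.form u u)⁻¹ := by
  -- For `w` orthogonal to `v` but not to `u`, the vectors `v + u` and `u` pair equally with `w`,
  -- which forces their scalars to agree. By symmetry `v + u` also shares its scalar with `v`.
  have key : ∀ {v u : V}, v ≠ 0 → u ∉ Submodule.span Fᵐᵒᵖ {v} →
      star (B.form (v + u) (v + u)) * (B.form (v + u) (v + u))⁻¹ =
        star (B.form u u) * (B.form u u)⁻¹ := by
    intro v u hv hu
    have hu0 : u ≠ 0 := fun h => hu (h ▸ zero_mem _)
    have hz0 : v + u ≠ 0 := fun h => hu (by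
      rw [← neg_eq_of_add_eq_zero_right h]
      exact neg_mem (Submodule.mem_span_singleton_self v))
    obtain ⟨w, hvw, huw⟩ := B.exists_form_eq_zero_form_ne_zero hv hu
    have h1 := B.star_form_eq hz0 w
    rw [B.form_add_right w, star_add, B.form_add_left v u w, hvw, zero_add,
      (B.orthosymmetric _ _).1 hvw, star_zero, zero_add, B.star_form_eq hu0] at h1
    exact (mul_right_cancel₀ huw h1).symm
  have hu0 : u ≠ 0 := fun h => hu (h ▸ zero_mem _)
  rw [← key hv hu, add_comm, key hu0]
  intro h
  obtain ⟨a, rfl⟩ := Submodule.mem_span_singleton.1 h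
  have ha : a ≠ 0 := fun h => hv (by rw [h, zero_smul])
  refine hu (Submodule.mem_span_singleton.2 ⟨a⁻¹, ?_⟩)
  rw [smul_smul, inv_mul_cancel₀ ha, one_smul]

/-- In dimension at least two the form is hermitian up to a scalar. -/
theorem exists_isHermitianUpTo (B : InnerProductForm F V) {v u : V} (hv : v ≠ 0)
    (hu : u ∉ Submodule.span Fᵐᵒᵖ {v}) : ∃ c, c ≠ 0 ∧ B.IsHermitianUpTo c := by
  have hvv := B.form_self_ne_zero hv
  refine ⟨star (B.form v v) * (B.form v v)⁻¹,
    mul_ne_zero (by simpa using hvv) (inv_ne_zero hvv), fun x w => ?_⟩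
  by_cases hx : x = 0
  · simp [hx, form_zero_left, form_zero_right]
  rw [B.star_form_eq hx]
  congr 1
  by_cases hxv : x ∈ Submodule.span Fᵐᵒᵖ {v}
  -- The vectors `x` and `v` are proportional here, so they are compared through `u`.
  · rw [B.form_scalar_eq hv hu]
    refine B.form_scalar_eq hx fun h => hu ?_
    exact (Submodule.span_singleton_le_iff_mem _ _).2 hxv h
  · exact (B.form_scalar_eq hv hxv).symm

end Hermitian

end InnerProductForm

/-! ### Representations with a hermitian form -/

section Representation

open InnerProductForm

/-- On a line an idempotent is determined by its scalar on `v`, which is `0` or `1`. For a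
quasi-inverse `x` of `r ≠ 0`, the idempotents `x r` and `r x` are non-zero, hence `1`. -/
theorem isUnit_of_regular_of_span_eq_top {F V R : Type u} [DivisionRing F] [AddCommGroup V]
    [Module Fᵐᵒᵖ V] [Ring R] (hreg : ∀ a : R, ∃ x : R, a * x * a = a)
    (D : R →+* Module.End Fᵐᵒᵖ V) (hD : Function.Injective D) {v : V} (hv : v ≠ 0)
    (hspan : ∀ u, u ∈ Submodule.span Fᵐᵒᵖ {v}) (r : R) : IsUnit r ∨ r = 0 := by
  by_cases hr : r = 0
  · exact Or.inr hr
  left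
  have hidem : ∀ e : R, e * e = e → e = 0 ∨ e = 1 := by
    intro e he
    obtain ⟨a, ha⟩ := Submodule.mem_span_singleton.1 (hspan (D e v))
    have hmul : D e (D e v) = D e v := by
      rw [← Module.End.mul_apply, ← map_mul, he]
    have haa : a = 0 ∨ a = 1 := by
      rw [← ha, map_smul, ← ha, smul_smul] at hmul
      have := smul_left_injective Fᵐᵒᵖ hv hmul
      rcases eq_or_ne a 0 with h | h
      · exact Or.inl h
      · exact Or.inr (mul_left_cancel₀ h (by rw [this, mul_one]))
    refine haa.imp (fun h => hD (LinearMap.ext fun u => ?_)) fun h => hD (LinearMap.ext fun u => ?_)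
    all_goals
      obtain ⟨b, rfl⟩ := Submodule.mem_span_singleton.1 (hspan u)
      rw [map_smul, ← ha, h]
      simp
  obtain ⟨x, hx⟩ := hreg r
  have h1 : x * r = 1 := by
    refine (hidem (x * r) (by rw [mul_assoc, ← mul_assoc r, hx])).resolve_left fun h => hr ?_
    rw [← hx, mul_assoc, h, mul_zero]
  have h2 : r * x = 1 := by
    refine (hidem (r * x) (by rw [← mul_assoc, hx])).resolve_left fun h => hr ?_
    rw [← hx, h, zero_mul]
  exact ⟨⟨r, x, h2, h1⟩, rfl⟩

/-- A division `*`-ring, as a one-dimensional inner product space over itself. -/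
def selfForm (F : Type u) [DivisionRing F] [StarRing F] : InnerProductForm F F where
  form a b := star a * b
  form_add_left a b c := by rw [star_add, add_mul]
  form_add_right a b c := mul_add _ _ _
  form_smul_left a v w := by rw [op_smul_eq_mul, star_mul, mul_assoc]
  form_smul_right a v w := by rw [op_smul_eq_mul, mul_assoc]
  anisotropic v h := by simpa using h
  orthosymmetric v w := by simp [or_comm]

/-- The left regular representation, on the right module over itself. -/
def leftRegular (F : Type u) [Ring F] : F →+* Module.End Fᵐᵒᵖ F where
  toFun r :=
    { toFun a := r * a
      map_add' := mul_add r
      map_smul' a b := (mul_assoc r b a.unop).symm }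
  map_one' := by ext; simp
  map_mul' r s := by ext; simp
  map_zero' := by ext; simp
  map_add' r s := by ext; simp

/-- A representable `*`-regular ring has a representation on a space whose form is hermitian up to
a scalar. -/
theorem IsRepresentable.exists_isHermitianUpTo {R : Type u} [Ring R] [StarRing R] [Nontrivial R]
    (hreg : IsStarRegular R) (hrep : IsRepresentable R) :
    ∃ (F V : Type u) (_ : DivisionRing F) (_ : StarRing F) (_ : AddCommGroup V)
      (_ : Module Fᵐᵒᵖ V) (B : InnerProductForm F V) (c : F) (D : R →+* Module.End Fᵐᵒᵖ V),
      c ≠ 0 ∧ B.IsHermitianUpTo c ∧ Function.Injective D ∧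
        ∀ r, B.IsAdjoint (D r) (D (star r)) := by
  obtain ⟨F, V, _, _, _, _, B, ι, hι, hadj⟩ := hrep
  let D : R →+* Module.End Fᵐᵒᵖ V := B.endStar.subtype.comp ι
  have hD : Function.Injective D := Subtype.val_injective.comp hι
  obtain ⟨v, hv⟩ : ∃ v : V, v ≠ 0 := by
    by_contra! h
    exact one_ne_zero (α := R) (hD (LinearMap.ext fun v => by rw [h v, map_zero, map_zero]))
  by_cases hspan : ∀ u, u ∈ Submodule.span Fᵐᵒᵖ {v}
  · let _ : DivisionRing R := DivisionRing.ofIsUnitOrEqZero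
      (isUnit_of_regular_of_span_eq_top hreg.regular D hD hv hspan)
    refine ⟨R, R, inferInstance, inferInstance, inferInstance, inferInstance, selfForm R, 1,
      leftRegular R, one_ne_zero, fun v w => ?_, fun r s h => ?_, fun r a b => ?_⟩
    · simp [selfForm]
    · simpa [leftRegular] using LinearMap.congr_fun h 1
    · simp [selfForm, leftRegular, mul_assoc]
  · push Not at hspan
    obtain ⟨u, hu⟩ := hspan
    obtain ⟨c, hc0, hc⟩ := B.exists_isHermitianUpTo hv hu
    exact ⟨F, V, _, _, _, _, B, c, D, hc0, hc, hD, hadj⟩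

end Representation

-- The proposition

attribute [local instance] HahnSeries.doublingModule HahnSeries.divisionRing

theorem mainTheorem3 {R : Type u} [Ring R] [StarRing R] [Nontrivial R]
    (hreg : IsStarRegular R) (hrep : IsRepresentable R) :
    ∃ (R' : Type u) (_ : Ring R') (_ : StarRing R') (M : TwoSidedIdeal R'),
      IsStarRegular R' ∧ IsRepresentable R' ∧
      -- `R'` is subdirectly irreducible, and `M` is its minimal ideal
      IsMonolith M ∧
      -- `R` embeds into `R'` as a unital `*`-ring
      (∃ f : R →+* R', Function.Injective f ∧ ∀ r, f (star r) = star (f r)) ∧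
      -- `R' / M`, with the involution `x + M ↦ x* + M`, is isomorphic to `R` as a `*`-ring
      (∃ e : M.ringCon.Quotient ≃+* R,
        ∀ x : R', e (M.ringCon.mk' (star x)) = star (e (M.ringCon.mk' x))) ∧
      (IsSemiartinian R' ↔ IsSemiartinian R) := by
  obtain ⟨F, V, _, _, _, _, B, c, D, hc0, hc, hD, hadj⟩ := hrep.exists_isHermitianUpTo hreg
  have : Nontrivial V := by
    by_contra h
    have := not_nontrivial_iff_subsingleton.1 h
    exact one_ne_zero (α := R) (hD (LinearMap.ext fun v => Subsingleton.elim _ _))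
  -- This group is linearly ordered, and its basis vectors are pairwise incongruent modulo `2`.
  let B' := B.hahnExtension (Γ := Lex (ℕ →₀ ℤ)) hc hc0
  let D' := (HahnSeries.mapEnd (Γ := Lex (ℕ →₀ ℤ)) (F := F) (V := V)).comp D
  refine B'.exists_subdirectly_irreducible_extension (D := D')
    (fun r => B.isAdjoint_mapEnd hc hc0 (hadj r)) (B.hahnExtension_isHermitianUpTo hc hc0)
    (HahnSeries.single_ne_zero hc0) hreg fun r hr => by_contra fun hr0 => ?_
  obtain ⟨v, hv⟩ : ∃ v, D r v ≠ 0 := by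
    by_contra! h
    exact hr0 (hD (LinearMap.ext fun v => by rw [h v, map_zero, LinearMap.zero_apply]))
  have happ : ∀ g : Lex (ℕ →₀ ℤ), D' r (HahnSeries.single g v) = HahnSeries.single g (D r v) := by
    intro g
    exact HahnSeries.map_single (D r : ZeroHom V V)
  refine B'.notMem_finiteRank_of_orthogonal
    (v := fun n => HahnSeries.single (toLex (Finsupp.single n 1)) v) (fun n => ?_)
    (fun m n hmn => ?_) hr
  · rw [happ]
    exact HahnSeries.single_ne_zero hv
  · rw [happ, happ]
    refine B.hahnExtension_form_single hc hc0 _ _ (fun g hg => ?_) _ _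
    -- The coordinate at `m` of the sum of the two basis vectors is `1`, which is odd.
    have h := DFunLike.congr_fun (congrArg ofLex hg) m
    simp [hmn.symm] at h
    omega
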